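/- Let $R$ be an associative ring with unit and let $M$ be an $R$-module (all modules are unital and on the same side). Let $\sigma(M)$ be the class of modules subgenerated by $M$, i.e. isomorphic to a submodule of a quotient of a direct sum of copies of $M$. For modules $P,N$, call $P$ almost $N$-projective if for every submodule $K\subseteq N$ with natural map $g:N\to N/K$ and every homomorphism $f:P\to N/K$, either there is a homomorphism $h:P\to N$ with $f=gh$, or there are a nonzero direct summand $N'$ of $N$ and a homomorphism $h':N'\to P$ with $g|_{N'}=fh'$. Call $P$ almost projective in $\sigma(M)$ if it is almost $N$-projective for every $N\in\sigma(M)$. A module $A$ is $M$-injective if every homomorphism from a submodule of $M$ to $A$ extends to $M$. A submodule $B$ of $N$ is small if $B+C=N$ implies $C=N$ for every submodule $C$ of $N$, and $N$ is an $I_0$-module if every non-small submodule of $N$ contains a nonzero direct summand of $N$. Then the following conditions are equivalent: 1. Every simple module in $\sigma(M)$ is almost projective in $\sigma(M)$. 2. Every module in $\sigma(M)$ is semisimple or contains a nonzero $M$-injective submodule. 3. Every module in $\sigma(M)$ is an $I_0$-module. -/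

import Mathlib

/-!
Almost projectivity of a simple module `S` against `N` is tested inside `N × S`: for
`f : S → N ⧸ K`, the pullback of `f` and `N → N ⧸ K` together with `N × 0` spans `N × S`, so it is
not small, and (3) provides a nonzero direct summand `D` of `N × S` inside it. Since the
endomorphism ring of `S` is local, either `S → D → S` is an automorphism and `f` lifts to `N`, or
`D → N` is split injective and its image is the summand required by (1).

For (1) ⇒ (2), embed `N` in an `M`-injective module `E` of `σ(M)`, the trace of `M` in an injective
module. Either every simple submodule of a quotient of `N` lifts to `N`, which makes `N`
semisimple, or `N` contains a nonzero direct summand of `E`.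

For (2) ⇒ (3), an `M`-injective submodule of a module in `σ(M)` is a direct summand, and a
semisimple submodule which together with `C` spans `N` contains a complement of `C`.
-/

universe u

section Definitions

variable (R : Type u) [Ring R]

/-- `N` belongs to `σ(M)`: it is subgenerated by `M`, i.e. isomorphic to a submodule of
a quotient of a direct sum of copies of `M`. -/
def IsSubgenerated (M N : Type u) [AddCommGroup M] [Module R M]
    [AddCommGroup N] [Module R N] : Prop :=
  ∃ (ι : Type u) (K : Submodule R (ι →₀ M)) (j : N →ₗ[R] ((ι →₀ M) ⧸ K)),
    Function.Injective j

/-- `A` is `M`-injective: every homomorphism from a submodule of `M` to `A` extends to `M`. -/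
def IsRelInjective (M A : Type u) [AddCommGroup M] [Module R M]
    [AddCommGroup A] [Module R A] : Prop :=
  ∀ (M' : Submodule R M) (f : M' →ₗ[R] A), ∃ g : M →ₗ[R] A, g ∘ₗ M'.subtype = f

/-- `P` is almost `N`-projective. Direct summands of `N` are the submodules having a complement
in the lattice of submodules. -/
def IsAlmostRelProjective (N P : Type u) [AddCommGroup N] [Module R N]
    [AddCommGroup P] [Module R P] : Prop :=
  ∀ (K : Submodule R N) (f : P →ₗ[R] (N ⧸ K)),
    (∃ h : P →ₗ[R] N, K.mkQ ∘ₗ h = f) ∨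
    (∃ N' : Submodule R N, N' ≠ ⊥ ∧ IsComplemented N' ∧
      ∃ h' : N' →ₗ[R] P, K.mkQ ∘ₗ N'.subtype = f ∘ₗ h')

/-- `P` is almost projective in the category `σ(M)`: it is almost `N`-projective for every
module `N` in `σ(M)`. -/
def IsAlmostProjectiveIn (M P : Type u) [AddCommGroup M] [Module R M]
    [AddCommGroup P] [Module R P] : Prop :=
  ∀ (N : Type u) [AddCommGroup N] [Module R N],
    IsSubgenerated R M N → IsAlmostRelProjective R N P

variable {R} in
/-- `B` is a small (superfluous) submodule of `N`. -/
def IsSmallSubmodule {N : Type u} [AddCommGroup N] [Module R N] (B : Submodule R N) : Prop :=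
  ∀ C : Submodule R N, B ⊔ C = ⊤ → C = ⊤

/-- `N` is an `I₀`-module: every non-small submodule contains a nonzero direct summand of `N`. -/
def IsIZeroModule (N : Type u) [AddCommGroup N] [Module R N] : Prop :=
  ∀ B : Submodule R N, ¬ IsSmallSubmodule B →
    ∃ D : Submodule R N, D ≤ B ∧ D ≠ ⊥ ∧ IsComplemented D

end Definitions

section

variable {R : Type*} [Ring R] {N E D S : Type*} [AddCommGroup N] [Module R N]
  [AddCommGroup E] [Module R E] [AddCommGroup D] [Module R D] [AddCommGroup S] [Module R S]

theorem isComplemented_range_of_leftInverse {a : D →ₗ[R] E} {r : E →ₗ[R] D}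
    (h : Function.LeftInverse r a) : IsComplemented (LinearMap.range a) := by
  refine ⟨_, LinearMap.isCompl_of_proj (f := a.rangeRestrict ∘ₗ r) ?_⟩
  rintro ⟨_, d, rfl⟩
  exact Subtype.ext (congrArg a (h d))

theorem range_ne_bot_of_injective [Nontrivial D] {a : D →ₗ[R] E} (ha : Function.Injective a) :
    LinearMap.range a ≠ ⊥ := by
  obtain ⟨d, hd⟩ := exists_ne (0 : D)
  rw [Ne, LinearMap.range_eq_bot]
  rintro rfl
  exact hd (ha rfl)

theorem exists_leftInverse_of_isUnit_one_sub_comp {a : D →ₗ[R] E} {b : D →ₗ[R] S}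
    {x : E →ₗ[R] D} {y : S →ₗ[R] D} (hxy : x ∘ₗ a + y ∘ₗ b = LinearMap.id)
    (hu : IsUnit (1 - b ∘ₗ y : Module.End R S)) :
    ∃ r : E →ₗ[R] D, Function.LeftInverse r a := by
  obtain ⟨c, hc⟩ := hu.exists_left_inv
  -- `1 + y c b` inverts `1 - y b = x a`.
  refine ⟨(LinearMap.id + y ∘ₗ c ∘ₗ b) ∘ₗ x, fun d => ?_⟩
  have hxa : x (a d) = d - y (b d) := eq_sub_of_add_eq (LinearMap.congr_fun hxy d)
  have hcb : c (b d - b (y (b d))) = b d := LinearMap.congr_fun hc (b d)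
  calc
    x (a d) + y (c (b (x (a d)))) = d - y (b d) + y (c (b d - b (y (b d)))) := by
      rw [hxa, map_sub b]
    _ = d := by rw [hcb, sub_add_cancel]

theorem isLocalRing_end_of_isSimpleModule [IsSimpleModule R S] : IsLocalRing (Module.End R S) := by
  classical
  have := IsSimpleModule.nontrivial R S
  exact .of_isUnit_or_isUnit_one_sub_self fun g => by
    by_cases hg : g = 0
    · exact .inr (by simp [hg])
    · exact .inl (IsUnit.mk0 g hg)

theorem exists_simple_submodule_quotient_of_ne_top {L : Submodule R N} (hL : L ≠ ⊤) :
    ∃ K : Submodule R N, L ≤ K ∧ ∃ S : Submodule R (N ⧸ K), IsSimpleModule R S := by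
  obtain ⟨x, -, hx⟩ := SetLike.exists_of_lt hL.lt_top
  obtain ⟨K, hLK, hxK, hmax⟩ := zorn_le_nonempty₀ {K : Submodule R N | x ∉ K}
    (fun c hc hchain K hK => ⟨sSup c, fun hxc => by
      obtain ⟨K', hK', hxK'⟩ := (Submodule.mem_sSup_of_directed ⟨K, hK⟩ hchain.directedOn).mp hxc
      exact hc hK' hxK', fun _ => le_sSup⟩) L hx
  refine ⟨K, hLK, R ∙ K.mkQ x, isSimpleModule_iff_isAtom.mpr (isAtom_iff_le_of_ge.mpr ⟨?_, ?_⟩)⟩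
  · rwa [Ne, Submodule.span_singleton_eq_bot, Submodule.mkQ_apply, Submodule.Quotient.mk_eq_zero]
  · intro S hS _
    rw [Submodule.span_singleton_le_iff_mem]
    by_contra hxS
    have hSK : S.comap K.mkQ ≤ K := hmax hxS (K.le_comap_mkQ S)
    apply hS
    rw [← Submodule.map_comap_eq_of_surjective K.mkQ_surjective S, eq_bot_iff,
      ← Submodule.mkQ_map_self K]
    exact Submodule.map_mono hSK

theorem isSemisimpleModule_of_forall_simple_submodule_quotient_lift
    (H : ∀ (K : Submodule R N) (S : Submodule R (N ⧸ K)), IsSimpleModule R S →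
      ∃ h : S →ₗ[R] N, K.mkQ ∘ₗ h = S.subtype) : IsSemisimpleModule R N := by
  refine .of_sSup_simples_eq_top ?_
  by_contra hsoc
  obtain ⟨K, hK, S, hS⟩ := exists_simple_submodule_quotient_of_ne_top hsoc
  obtain ⟨h, hh⟩ := H K S hS
  have hinj : Function.Injective h := by
    have := S.injective_subtype
    rw [← hh, LinearMap.coe_comp] at this
    exact this.of_comp
  have hsimple : IsSimpleModule R (LinearMap.range h) :=
    .congr (LinearEquiv.ofInjective h hinj).symm
  have hrange : LinearMap.range h ≤ K := hK.trans' (le_sSup hsimple)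
  have := IsSimpleModule.nontrivial R S
  obtain ⟨s, hs⟩ := exists_ne (0 : S)
  refine hs (Subtype.ext ?_)
  calc
    (s : N ⧸ K) = K.mkQ (h s) := (LinearMap.congr_fun hh s).symm
    _ = 0 := (Submodule.Quotient.mk_eq_zero K).mpr (hrange ⟨s, rfl⟩)

theorem exists_comp_eq_of_range_le {e : N →ₗ[R] E} (he : Function.Injective e) {h : S →ₗ[R] E}
    (hr : LinearMap.range h ≤ LinearMap.range e) : ∃ g : S →ₗ[R] N, e ∘ₗ g = h := by
  let e' := LinearEquiv.ofInjective e he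
  refine ⟨e'.symm.toLinearMap ∘ₗ h.codRestrict _ fun s => hr ⟨s, rfl⟩, LinearMap.ext fun s => ?_⟩
  exact congrArg Subtype.val (e'.apply_symm_apply _)

theorem exists_preimage_of_mkQ_eq_mapQ {e : N →ₗ[R] E} {K : Submodule R N} {y : E} {s : N ⧸ K}
    (h : (K.map e).mkQ y = K.mapQ (K.map e) e (Submodule.le_comap_map e K) s) :
    ∃ t : N, e t = y ∧ K.mkQ t = s := by
  obtain ⟨t, rfl⟩ := K.mkQ_surjective s
  obtain ⟨k, hk, hky⟩ := (Submodule.Quotient.eq _).mp h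
  exact ⟨k + t, by rw [map_add, hky, sub_add_cancel], by simpa using hk⟩

end

section

variable (R : Type*) [Ring R] (M X : Type*) [AddCommGroup M] [Module R M]
  [AddCommGroup X] [Module R X]

/-- The trace of `M` in `X`: the largest `M`-generated submodule of `X`. In particular `X` is
generated by `M`, i.e. a quotient of a direct sum of copies of `M`, when its trace is `⊤`. -/
def traceSubmodule : Submodule R X :=
  ⨆ f : M →ₗ[R] X, LinearMap.range f

variable {R M X}

theorem apply_mem_traceSubmodule (f : M →ₗ[R] X) (m : M) : f m ∈ traceSubmodule R M X :=
  le_iSup (fun f : M →ₗ[R] X => LinearMap.range f) f ⟨m, rfl⟩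

theorem range_lsum_eq_traceSubmodule :
    LinearMap.range (Finsupp.lsum ℕ fun f : M →ₗ[R] X => f) = traceSubmodule R M X := by
  rw [LinearMap.range_eq_map, ← Finsupp.iSup_lsingle_range, Submodule.map_iSup]
  simp only [← LinearMap.range_comp, Finsupp.lsum_comp_lsingle, traceSubmodule]

theorem traceSubmodule_eq_top_of_surjective {ι : Type*} {p : (ι →₀ M) →ₗ[R] X}
    (hp : Function.Surjective p) : traceSubmodule R M X = ⊤ := by
  rw [eq_top_iff, ← LinearMap.range_eq_top.mpr hp, LinearMap.range_eq_map,
    ← Finsupp.iSup_lsingle_range, Submodule.map_iSup, iSup_le_iff]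
  rintro i _ ⟨_, ⟨m, rfl⟩, rfl⟩
  exact apply_mem_traceSubmodule (p ∘ₗ Finsupp.lsingle i) m

end

section

variable {R : Type u} [Ring R] {M N E A S : Type u} [AddCommGroup M] [Module R M]
  [AddCommGroup N] [Module R N] [AddCommGroup E] [Module R E] [AddCommGroup A] [Module R A]
  [AddCommGroup S] [Module R S]

namespace IsSubgenerated

theorem of_surjective_of_injective {ι : Type u} {p : (ι →₀ M) →ₗ[R] E}
    (hp : Function.Surjective p) {j : N →ₗ[R] E} (hj : Function.Injective j) :
    IsSubgenerated R M N :=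
  ⟨ι, LinearMap.ker p, (p.quotKerEquivOfSurjective hp).symm.toLinearMap ∘ₗ j,
    (p.quotKerEquivOfSurjective hp).symm.injective.comp hj⟩

theorem submodule (hN : IsSubgenerated R M N) (B : Submodule R N) : IsSubgenerated R M B := by
  obtain ⟨ι, K, j, hj⟩ := hN
  exact ⟨ι, K, j ∘ₗ B.subtype, hj.comp B.injective_subtype⟩

theorem quotient (hN : IsSubgenerated R M N) (B : Submodule R N) :
    IsSubgenerated R M (N ⧸ B) := by
  obtain ⟨ι, K, j, hj⟩ := hN
  refine of_surjective_of_injective (p := (B.map j).mkQ ∘ₗ K.mkQ)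
    (j := B.mapQ (B.map j) j (Submodule.le_comap_map j B))
    ((B.map j).mkQ_surjective.comp K.mkQ_surjective) ?_
  rw [← LinearMap.ker_eq_bot, Submodule.ker_mapQ, Submodule.comap_map_eq_of_injective hj,
    Submodule.mkQ_map_self]

theorem prod (hN : IsSubgenerated R M N) (hE : IsSubgenerated R M E) :
    IsSubgenerated R M (N × E) := by
  obtain ⟨ι, K, j, hj⟩ := hN
  obtain ⟨κ, L, k, hk⟩ := hE
  exact of_surjective_of_injective
    (p := K.mkQ.prodMap L.mkQ ∘ₗ (Finsupp.sumFinsuppLEquivProdFinsupp R).toLinearMap)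
    (j := j.prodMap k)
    ((K.mkQ_surjective.prodMap L.mkQ_surjective).comp (LinearEquiv.surjective _))
    (hj.prodMap hk)

theorem exists_injective_traceSubmodule_eq_top (hN : IsSubgenerated R M N) :
    ∃ (Q : Type u) (_ : AddCommGroup Q) (_ : Module R Q) (j : N →ₗ[R] Q),
      Function.Injective j ∧ traceSubmodule R M Q = ⊤ := by
  obtain ⟨ι, K, j, hj⟩ := hN
  exact ⟨_, _, _, j, hj, traceSubmodule_eq_top_of_surjective K.mkQ_surjective⟩

theorem apply_mem_traceSubmodule_of_injective [Module.Injective R E] (hN : IsSubgenerated R M N)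
    (i : N →ₗ[R] E) (x : N) : i x ∈ traceSubmodule R M E := by
  obtain ⟨Q, _, _, j, hj, htop⟩ := hN.exists_injective_traceSubmodule_eq_top
  obtain ⟨k, hk⟩ := Module.Injective.out j hj i
  have hle : traceSubmodule R M Q ≤ (traceSubmodule R M E).comap k := by
    refine iSup_le fun f => ?_
    rintro _ ⟨m, rfl⟩
    exact apply_mem_traceSubmodule (k ∘ₗ f) m
  rw [← hk]
  exact hle (htop ▸ Submodule.mem_top)

end IsSubgenerated

variable (M E) in
theorem isSubgenerated_traceSubmodule : IsSubgenerated R M (traceSubmodule R M E) := by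
  rw [← range_lsum_eq_traceSubmodule]
  exact .of_surjective_of_injective (LinearMap.surjective_rangeRestrict _)
    (j := LinearMap.id) Function.injective_id

variable (M E) in
theorem isRelInjective_traceSubmodule [Module.Injective R E] :
    IsRelInjective R M (traceSubmodule R M E) := by
  intro M' f
  obtain ⟨g, hg⟩ := Module.Injective.out M'.subtype M'.injective_subtype
    ((traceSubmodule R M E).subtype ∘ₗ f)
  exact ⟨g.codRestrict _ (apply_mem_traceSubmodule g), LinearMap.ext fun x => Subtype.ext (hg x)⟩

namespace IsRelInjective

theorem of_leftInverse (hE : IsRelInjective R M E) {i : A →ₗ[R] E} {r : E →ₗ[R] A}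
    (hri : Function.LeftInverse r i) : IsRelInjective R M A := by
  intro M' f
  obtain ⟨g, hg⟩ := hE M' (i ∘ₗ f)
  refine ⟨r ∘ₗ g, LinearMap.ext fun x => ?_⟩
  exact (congrArg r (LinearMap.congr_fun hg x)).trans (hri (f x))

theorem of_linearEquiv (hE : IsRelInjective R M E) (e : A ≃ₗ[R] E) : IsRelInjective R M A :=
  hE.of_leftInverse (i := e.toLinearMap) (r := e.symm.toLinearMap) e.symm_apply_apply

theorem of_isComplemented (hE : IsRelInjective R M E) {D : Submodule R E}
    (hD : IsComplemented D) : IsRelInjective R M D := by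
  obtain ⟨C, hC⟩ := hD
  exact hE.of_leftInverse (i := D.subtype) (Submodule.projectionOnto_apply_left hC)

theorem exists_extension (hA : IsRelInjective R M A) {i : N →ₗ[R] M}
    (hi : Function.Injective i) (f : N →ₗ[R] A) : ∃ g : M →ₗ[R] A, g ∘ₗ i = f := by
  let e := LinearEquiv.ofInjective i hi
  obtain ⟨g, hg⟩ := hA (LinearMap.range i) (f ∘ₗ e.symm.toLinearMap)
  refine ⟨g, LinearMap.ext fun x => ?_⟩
  exact (LinearMap.congr_fun hg (e x)).trans (congrArg f (e.symm_apply_apply x))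

theorem of_injective (hA : IsRelInjective R E A) {j : N →ₗ[R] E} (hj : Function.Injective j) :
    IsRelInjective R N A := by
  intro N' f
  obtain ⟨g, hg⟩ := hA.exists_extension (i := j ∘ₗ N'.subtype) (hj.comp N'.injective_subtype) f
  exact ⟨g ∘ₗ j, hg⟩

theorem exists_le_range_le_domain (hA : IsRelInjective R M A) (g : N →ₗ.[R] A)
    (p : M →ₗ[R] N) : ∃ g' : N →ₗ.[R] A, g ≤ g' ∧ LinearMap.range p ≤ g'.domain := by
  obtain ⟨k, hk⟩ := hA (g.domain.comap p) (g.toFun ∘ₗ p.restrict fun _ hx => hx)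
  have hkg : ∀ m (hm : p m ∈ g.domain), k m = g ⟨p m, hm⟩ := fun m hm =>
    LinearMap.congr_fun hk ⟨m, hm⟩
  have hker : LinearMap.ker p ≤ LinearMap.ker k := by
    intro m hm
    have hm0 : p m = 0 := hm
    rw [LinearMap.mem_ker, hkg m (hm0 ▸ zero_mem _), ← g.map_zero]
    exact congrArg g (Subtype.ext hm0)
  let s : N →ₗ.[R] A :=
    ⟨LinearMap.range p, (LinearMap.ker p).liftQ k hker ∘ₗ p.quotKerEquivRange.symm.toLinearMap⟩
  have hs : ∀ m, s ⟨p m, m, rfl⟩ = k m := fun m =>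
    congrArg ((LinearMap.ker p).liftQ k hker) (p.quotKerEquivRange_symm_apply_image m ⟨m, rfl⟩)
  have hgs : ∀ (x : g.domain) (y : s.domain), (x : N) = y → g x = s y := by
    rintro ⟨_, hx⟩ ⟨_, m, rfl⟩ rfl
    exact ((hs m).trans (hkg m hx)).symm
  exact ⟨g.sup s hgs, g.left_le_sup s hgs, (g.right_le_sup s hgs).1⟩

theorem of_traceSubmodule_eq_top (hA : IsRelInjective R M A)
    (hN : traceSubmodule R M N = ⊤) : IsRelInjective R N A := by
  intro N' f
  obtain ⟨g, hfg, hmax⟩ := zorn_le_nonempty_Ici₀ (⟨N', f⟩ : N →ₗ.[R] A)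
    (fun c _ hc _ _ => ⟨LinearPMap.sSup c hc.directedOn,
      fun _ => LinearPMap.le_sSup hc.directedOn⟩) ⟨N', f⟩ le_rfl
  have htop : g.domain = ⊤ := by
    rw [eq_top_iff, ← hN]
    refine iSup_le fun p => ?_
    obtain ⟨g', hgg', hp⟩ := hA.exists_le_range_le_domain g p
    exact hp.trans (hmax hgg').1
  refine ⟨g.toFun ∘ₗ LinearMap.codRestrict g.domain LinearMap.id fun _ => htop ▸ trivial, ?_⟩
  ext x
  exact (hfg.2 (x := x) rfl).symm

theorem of_isSubgenerated (hA : IsRelInjective R M A) (hN : IsSubgenerated R M N) :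
    IsRelInjective R N A := by
  obtain ⟨Q, _, _, j, hj, hQ⟩ := hN.exists_injective_traceSubmodule_eq_top
  exact (hA.of_traceSubmodule_eq_top hQ).of_injective hj

theorem isComplemented_range (hA : IsRelInjective R M A) (hN : IsSubgenerated R M N)
    {i : A →ₗ[R] N} (hi : Function.Injective i) : IsComplemented (LinearMap.range i) := by
  obtain ⟨r, hr⟩ := (hA.of_isSubgenerated hN).exists_extension hi LinearMap.id
  exact isComplemented_range_of_leftInverse (LinearMap.congr_fun hr)

end IsRelInjective

theorem IsSubgenerated.exists_isRelInjective (hN : IsSubgenerated R M N) :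
    ∃ (E : Type u) (_ : AddCommGroup E) (_ : Module R E) (e : N →ₗ[R] E),
      Function.Injective e ∧ IsSubgenerated R M E ∧ IsRelInjective R M E := by
  obtain ⟨I, hI, φ, hφ⟩ := CategoryTheory.EnoughInjectives.presentation (ModuleCat.of R N)
  have : Module.Injective R I := (Module.injective_iff_injective_object R I).mpr hI
  have hφi : Function.Injective φ.hom := (ModuleCat.mono_iff_injective φ).mp hφ
  refine ⟨traceSubmodule R M I, inferInstance, inferInstance,
    φ.hom.codRestrict _ (hN.apply_mem_traceSubmodule_of_injective φ.hom), ?_,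
    isSubgenerated_traceSubmodule M I, isRelInjective_traceSubmodule M I⟩
  exact (LinearMap.injective_codRestrict_iff ..).mpr hφi

theorem IsAlmostRelProjective.exists_lift_or_exists_isComplemented
    (hS : IsAlmostRelProjective R E S) {e : N →ₗ[R] E} (he : Function.Injective e)
    {K : Submodule R N} (f : S →ₗ[R] N ⧸ K) :
    (∃ h : S →ₗ[R] N, K.mkQ ∘ₗ h = f) ∨
      ∃ D ≤ LinearMap.range e, D ≠ ⊥ ∧ IsComplemented D := by
  rcases hS (K.map e) (K.mapQ (K.map e) e (Submodule.le_comap_map e K) ∘ₗ f) with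
    ⟨h, hh⟩ | ⟨D, hD, hDc, h', hh'⟩
  · have hpre : ∀ s, ∃ t, e t = h s ∧ K.mkQ t = f s := fun s =>
      exists_preimage_of_mkQ_eq_mapQ (LinearMap.congr_fun hh s)
    have hrange : LinearMap.range h ≤ LinearMap.range e := by
      rintro _ ⟨s, rfl⟩
      exact (hpre s).imp fun _ => And.left
    obtain ⟨g, hg⟩ := exists_comp_eq_of_range_le he hrange
    refine .inl ⟨g, LinearMap.ext fun s => ?_⟩
    obtain ⟨t, hth, htf⟩ := hpre s
    have hgt : g s = t := he ((LinearMap.congr_fun hg s).trans hth.symm)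
    rw [LinearMap.comp_apply, hgt, htf]
  · refine .inr ⟨D, fun d hd => ?_, hD, hDc⟩
    obtain ⟨t, ht, -⟩ := exists_preimage_of_mkQ_eq_mapQ (LinearMap.congr_fun hh' ⟨d, hd⟩)
    exact ⟨t, ht⟩

theorem IsSubgenerated.isSemisimpleModule_or_exists_isRelInjective (hN : IsSubgenerated R M N)
    (H : ∀ (S : Type u) [AddCommGroup S] [Module R S],
      IsSubgenerated R M S → IsSimpleModule R S → IsAlmostProjectiveIn R M S) :
    IsSemisimpleModule R N ∨ ∃ A : Submodule R N, A ≠ ⊥ ∧ IsRelInjective R M A := by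
  refine or_iff_not_imp_right.mpr fun hno =>
    isSemisimpleModule_of_forall_simple_submodule_quotient_lift fun K S hS => ?_
  obtain ⟨E, _, _, e, he, hEM, hE⟩ := hN.exists_isRelInjective
  refine ((H S ((hN.quotient K).submodule S) hS E hEM).exists_lift_or_exists_isComplemented he
    S.subtype).resolve_right ?_
  rintro ⟨D, hDe, hD, hDc⟩
  have hcomap : (D.comap e).map e = D := Submodule.map_comap_eq_of_le hDe
  refine hno ⟨D.comap e, fun h => hD (by rw [← hcomap, h, Submodule.map_bot]), ?_⟩
  have hDinj := hE.of_isComplemented hDc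
  rw [← hcomap] at hDinj
  exact hDinj.of_linearEquiv (Submodule.equivMapOfInjective e he _)

theorem exists_isComplemented_le_of_isSemisimpleModule {B : Submodule R N} [IsSemisimpleModule R B]
    (hB : ¬ IsSmallSubmodule B) : ∃ D ≤ B, D ≠ ⊥ ∧ IsComplemented D := by
  simp only [IsSmallSubmodule, not_forall] at hB
  obtain ⟨C, hBC, hC⟩ := hB
  have hsurj : Function.Surjective (C.mkQ ∘ₗ B.subtype) := by
    rw [← LinearMap.range_eq_top, LinearMap.range_comp, B.range_subtype, Submodule.map_mkQ_eq_top,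
      sup_comm, hBC]
  obtain ⟨s, hs⟩ := IsSemisimpleModule.lifting_property _ hsurj LinearMap.id
  have hinv : Function.LeftInverse C.mkQ (B.subtype ∘ₗ s) := LinearMap.congr_fun hs
  have : Nontrivial (N ⧸ C) := Submodule.Quotient.nontrivial_iff.mpr hC
  refine ⟨_, ?_, range_ne_bot_of_injective hinv.injective,
    isComplemented_range_of_leftInverse hinv⟩
  rintro _ ⟨y, rfl⟩
  exact (s y).2

theorem IsSubgenerated.isIZeroModule (hN : IsSubgenerated R M N)
    (H : ∀ B : Submodule R N, IsSemisimpleModule R B ∨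
      ∃ A : Submodule R B, A ≠ ⊥ ∧ IsRelInjective R M A) : IsIZeroModule R N := by
  intro B hB
  rcases H B with _ | ⟨A, hA, hAinj⟩
  · exact exists_isComplemented_le_of_isSemisimpleModule hB
  · have hinj : Function.Injective (B.subtype ∘ₗ A.subtype) :=
      B.injective_subtype.comp A.injective_subtype
    have := Submodule.nontrivial_iff_ne_bot.mpr hA
    refine ⟨_, ?_, range_ne_bot_of_injective hinj, hAinj.isComplemented_range hN hinj⟩
    rintro _ ⟨a, rfl⟩
    exact a.1.2

theorem not_isSmallSubmodule_eqLocus [Nontrivial S] {K : Submodule R N} (f : S →ₗ[R] N ⧸ K) :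
    ¬ IsSmallSubmodule (LinearMap.eqLocus (K.mkQ ∘ₗ LinearMap.fst R N S)
      (f ∘ₗ LinearMap.snd R N S)) := by
  intro hsmall
  have htop : LinearMap.range (LinearMap.inl R N S) = ⊤ := by
    refine hsmall _ (eq_top_iff.mpr ?_)
    rintro ⟨x, s⟩ -
    obtain ⟨t, ht⟩ := K.mkQ_surjective (f s)
    exact Submodule.mem_sup.mpr ⟨(t, s), ht, (x - t, 0), ⟨x - t, rfl⟩, by simp⟩
  obtain ⟨s, hs⟩ := exists_ne (0 : S)
  obtain ⟨x, hx⟩ : ((0, s) : N × S) ∈ LinearMap.range (LinearMap.inl R N S) :=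
    htop ▸ Submodule.mem_top
  exact hs (congrArg Prod.snd hx).symm

theorem IsIZeroModule.isAlmostRelProjective [IsLocalRing (Module.End R S)]
    (hI : IsIZeroModule R (N × S)) : IsAlmostRelProjective R N S := by
  intro K f
  have : Nontrivial S := by
    by_contra hS
    rw [not_nontrivial_iff_subsingleton] at hS
    exact not_subsingleton (Module.End R S) inferInstance
  obtain ⟨D, hDB, hD, C, hC⟩ := hI _ (not_isSmallSubmodule_eqLocus f)
  let p := D.projectionOnto C hC
  let a : D →ₗ[R] N := LinearMap.fst R N S ∘ₗ D.subtype
  let b : D →ₗ[R] S := LinearMap.snd R N S ∘ₗ D.subtype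
  let x : N →ₗ[R] D := p ∘ₗ LinearMap.inl R N S
  let y : S →ₗ[R] D := p ∘ₗ LinearMap.inr R N S
  have hab : K.mkQ ∘ₗ a = f ∘ₗ b := LinearMap.ext fun d => hDB d.2
  have hxy : x ∘ₗ a + y ∘ₗ b = LinearMap.id := by
    ext1 d
    calc
      p ((d : N × S).1, 0) + p (0, (d : N × S).2) = p d := by rw [← map_add]; simp
      _ = d := Submodule.projectionOnto_apply_left hC d
  rcases IsLocalRing.isUnit_or_isUnit_of_add_one
    (add_sub_cancel (b ∘ₗ y : Module.End R S) 1) with hu | hu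
  · obtain ⟨c, hc⟩ := hu.exists_right_inv
    exact .inl ⟨a ∘ₗ y ∘ₗ c, LinearMap.ext fun s =>
      (LinearMap.congr_fun hab (y (c s))).trans (congrArg f (LinearMap.congr_fun hc s))⟩
  · obtain ⟨r, hr⟩ := exists_leftInverse_of_isUnit_one_sub_comp hxy hu
    have := Submodule.nontrivial_iff_ne_bot.mpr hD
    refine .inr ⟨LinearMap.range a, range_ne_bot_of_injective hr.injective,
      isComplemented_range_of_leftInverse hr, b ∘ₗ r ∘ₗ Submodule.subtype _, ?_⟩
    ext ⟨_, d, rfl⟩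
    change K.mkQ (a d) = f (b (r (a d)))
    rw [hr d]
    exact LinearMap.congr_fun hab d

end

theorem theorem1p1 {R : Type u} [Ring R] (M : Type u) [AddCommGroup M] [Module R M] :
    List.TFAE [
      ∀ (S : Type u) [AddCommGroup S] [Module R S],
        IsSubgenerated R M S → IsSimpleModule R S → IsAlmostProjectiveIn R M S,
      ∀ (N : Type u) [AddCommGroup N] [Module R N],
        IsSubgenerated R M N →
          IsSemisimpleModule R N ∨
            ∃ A : Submodule R N, A ≠ ⊥ ∧ IsRelInjective R M A,
      ∀ (N : Type u) [AddCommGroup N] [Module R N],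
        IsSubgenerated R M N → IsIZeroModule R N] := by
  tfae_have 1 → 2 := fun h N _ _ hN => hN.isSemisimpleModule_or_exists_isRelInjective h
  tfae_have 2 → 3 := fun h N _ _ hN => hN.isIZeroModule fun B => h B (hN.submodule B)
  tfae_have 3 → 1 := fun h S _ _ hS _ N _ _ hN =>
    have := isLocalRing_end_of_isSimpleModule (R := R) (S := S)
    (h (N × S) (hN.prod hS)).isAlmostRelProjective
  tfae_finish
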